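/- Let $m,d\ge 0$ be integers, $\mathcal X\subset\mathbb R^d$ compact, $(\Omega,\mathcal F,\mathbb P)$ a probability space, and $X_1,X_2,\dots:\Omega\to\mathcal X$ i.i.d. random vectors with common law $\mu$. Let $C\in\mathbb R^{m\times d}$, $\alpha>0$, and let $g:\mathbb R^m\to\overline{\mathbb R}$ be proper, lower semicontinuous and convex, with conjugate $g^*(y)=\sup_{x}\{\langle x,y\rangle-g(x)\}$. For a function $f$ with values in $\overline{\mathbb R}$ write $\operatorname{dom} f=\{f<+\infty\}$. For a Borel probability measure $\nu$ on $\mathcal X$ put $$L_\nu(y)=\log\int e^{\langle y,x\rangle}\,d\nu(x),\qquad \phi_\nu(z)=\alpha g^*(-z/\alpha)+L_\nu(C^Tz),$$ and let $$\kappa_\mu(y)=\inf\{\mathrm{KL}(Q\,\|\,\mu): Q \text{ a Borel probability measure on }\mathcal X,\ \textstyle\int x\,dQ(x)=y\},$$ where $\mathrm{KL}(Q\,\|\,\mu)=\int\log\frac{dQ}{d\mu}\,dQ$ if $Q\ll\mu$ and $+\infty$ otherwise. Let $\mu_n^{(\omega)}=\frac1n\sum_{i=1}^n\delta_{X_i(\omega)}$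 be the empirical measures. Assume $0\in\operatorname{int}(\operatorname{dom} g-C\operatorname{dom}\kappa_\mu)$. Then the primal problem $\min_{x\in\mathbb R^d}\ \alpha g(Cx)+\kappa_\mu(x)$ has a unique solution $\overline x_\mu$, and there is a measurable set $\Xi\subseteq\Omega$ with $\mathbb P(\Xi)=1$ such that for every $\omega\in\Xi$ the following holds. Let $\varepsilon_n\downarrow 0$, let $z_n\in\mathbb R^m$ satisfy $$\phi_{\mu_n^{(\omega)}}(z_n)\le\inf_z\phi_{\mu_n^{(\omega)}}(z)+\varepsilon_n\quad\text{for all sufficiently large } n,$$ and put $x_n=\nabla L_{\mu_n^{(\omega)}}(C^Tz_n)\in\mathbb R^d$. Then: 1. for every convergent subsequence $(z_{n_k})_k$ of $(z_n)$, $\lim_{k\to\infty}x_{n_k}=\overline x_\mu$; 2. if $\phi_\mu$ has a unique minimizer, then $x_n\to\overline x_\mu$. -/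

import Mathlib

open MeasureTheory Filter
open scoped Topology ENNReal Pointwise Matrix

noncomputable section

namespace MEM

/-- The Euclidean space `ℝⁿ`. -/
abbrev Vec (n : ℕ) : Type := EuclideanSpace ℝ (Fin n)

/-! ### Convex analysis for extended-real-valued functions -/

/-- The effective domain `{x | f x < +∞}`. -/
def dom {E : Type*} (f : E → EReal) : Set E := {x | f x < ⊤}

/-- `f` is proper: its domain is nonempty and it never takes the value `-∞`. -/
def Proper {E : Type*} (f : E → EReal) : Prop :=
  (dom f).Nonempty ∧ ∀ x, ⊥ < f x

/-- Convexity of a proper function with values in the extended reals. -/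
def ConvexFun {E : Type*} [AddCommGroup E] [Module ℝ E] (f : E → EReal) : Prop :=
  ∀ x ∈ dom f, ∀ y ∈ dom f, ∀ t : ℝ, 0 < t → t < 1 →
    f (t • x + (1 - t) • y) ≤ (t : EReal) * f x + ((1 - t : ℝ) : EReal) * f y

/-- The Fenchel conjugate `f*(y) = sup_x (⟨x, y⟩ - f x)`. -/
def conjugate {n : ℕ} (f : Vec n → EReal) (y : Vec n) : EReal :=
  ⨆ x : Vec n, ((inner ℝ x y : ℝ) : EReal) - f x

/-- The set of (global) minimizers of `f`. -/
def argmin {E : Type*} (f : E → EReal) : Set E := {x | f x ≤ ⨅ y, f y}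

/-- `x` is an `ε`-minimizer of `f`. -/
def IsApproxMin {E : Type*} (f : E → EReal) (ε : ℝ) (x : E) : Prop :=
  f x ≤ (⨅ y, f y) + (ε : EReal)

/-! ### Maximum entropy on the mean -/

/-- The log-moment generating function `L_ν(y) = log ∫ exp ⟨y, x⟩ dν(x)`. -/
def logMGF {d : ℕ} (ν : Measure (Vec d)) (y : Vec d) : ℝ :=
  Real.log (∫ x, Real.exp (inner ℝ y x) ∂ν)

/-- The MEM function `κ_μ(y)`: the infimum of `KL(Q ‖ μ)` over the Borel probability measures `Q`
on `K` (that is, on `ℝᵈ` and giving no mass to the complement of `K`) whose mean is `y`. -/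
def memFun {d : ℕ} (K : Set (Vec d)) (μ : Measure (Vec d)) (y : Vec d) : EReal :=
  ((⨅ (Q : Measure (Vec d)) (_ : IsProbabilityMeasure Q ∧ Q Kᶜ = 0 ∧ ∫ x, x ∂Q = y),
    InformationTheory.klDiv Q μ : ℝ≥0∞) : EReal)

/-- The primal objective `x ↦ α g(C x) + κ_μ(x)`. -/
def primalObj {m d : ℕ} (g : Vec m → EReal) (C : Matrix (Fin m) (Fin d) ℝ) (α : ℝ)
    (K : Set (Vec d)) (μ : Measure (Vec d)) (x : Vec d) : EReal :=
  (α : EReal) * g (Matrix.toEuclideanLin C x) + memFun K μ x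

/-- The dual objective `φ_ν(z) = α g*(-z/α) + L_ν(Cᵀ z)`. -/
def dualObj {m d : ℕ} (g : Vec m → EReal) (C : Matrix (Fin m) (Fin d) ℝ) (α : ℝ)
    (ν : Measure (Vec d)) (z : Vec m) : EReal :=
  (α : EReal) * conjugate g (-(α⁻¹ • z)) + (logMGF ν (Matrix.toEuclideanLin Cᵀ z) : EReal)

/-- The empirical measure `(1/n) ∑_{i < n} δ_{X i ω}` of the first `n` samples. -/
def empirical {d : ℕ} {Ω : Type*} (X : ℕ → Ω → Vec d) (n : ℕ) (ω : Ω) : Measure (Vec d) :=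
  (n : ℝ≥0∞)⁻¹ • ∑ i ∈ Finset.range n, Measure.dirac (X i ω)

end MEM

end

noncomputable section

namespace MEM

/-! ### The log-moment generating function of a compactly supported measure -/

/-! Everything rests on the tilted mean, which is the gradient of $L_\nu$. The tilted measure
attains equality in the Donsker–Varadhan inequality, so $\kappa_\mu$ is known exactly at tilted
means and bounded below by $\langle y,x\rangle-L_\mu(y)$ everywhere.

Duality: the interior condition gives the dual objective bounded sublevel sets, hence a minimizer
$\bar z$. First-order optimality at $\bar z$ shows that $\nabla L_\mu(C^T\bar z)$ closes the duality
gap, and the equality case makes it the only primal solution (`argmin_primalObj_eq`). All dual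
minimizers therefore yield the same primal point.

Stability: a strong law over a countable dense set of continuous functions gives one almost sure
event on which $L_{\mu_n}(w_n)\to L_\mu(w)$, and likewise for tilted means, whenever $w_n\to w$
(`ae_tendsto_logMGF_tiltedMean`). On it, cluster points of approximate dual minimizers minimize
$\phi_\mu$ (`mem_argmin_of_tendsto`), so the corresponding $x_n$ converge to the common primal
point. If the minimizer is unique, convexity prevents the approximate minimizers from staying away
from it (`tendsto_of_argmin_eq_singleton`). -/

/-- The mean of the exponential tilting of `ν` by `⟨y, ·⟩`. -/
def tiltedMean {d : ℕ} (ν : Measure (Vec d)) (y : Vec d) : Vec d :=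
  (∫ x, Real.exp (inner ℝ y x) ∂ν)⁻¹ • ∫ x, Real.exp (inner ℝ y x) • x ∂ν

section CompactSupport

variable {d : ℕ} {K : Set (Vec d)} {ν : Measure (Vec d)}

lemma restrict_eq_self_of_compl_null (h : ν Kᶜ = 0) : ν.restrict K = ν :=
  Measure.restrict_eq_self_of_ae_mem (by rw [ae_iff]; exact h)

lemma integrable_of_continuous_of_compact [IsFiniteMeasure ν] {E : Type*} [NormedAddCommGroup E]
    (hK : IsCompact K) (h : ν Kᶜ = 0) {f : Vec d → E} (hf : Continuous f) : Integrable f ν := by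
  have := hf.continuousOn.integrableOn_compact (μ := ν) hK
  rwa [IntegrableOn, restrict_eq_self_of_compl_null h] at this

lemma integral_exp_inner_pos [IsProbabilityMeasure ν] (hK : IsCompact K) (h : ν Kᶜ = 0)
    (y : Vec d) : 0 < ∫ x, Real.exp (inner ℝ y x) ∂ν :=
  integral_exp_pos (integrable_of_continuous_of_compact hK h (by fun_prop))

lemma continuous_integral_exp_inner [IsProbabilityMeasure ν] (hK : IsCompact K) (h : ν Kᶜ = 0) :
    Continuous fun y : Vec d => ∫ x, Real.exp (inner ℝ y x) ∂ν := by
  have := continuous_parametric_integral_of_continuous (μ := ν) (X := Vec d)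
    (f := fun y x : Vec d => Real.exp (inner ℝ y x)) (by fun_prop) hK
  rwa [restrict_eq_self_of_compl_null h] at this

lemma continuous_tiltedMean [IsProbabilityMeasure ν] (hK : IsCompact K) (h : ν Kᶜ = 0) :
    Continuous (tiltedMean ν) := by
  have := continuous_parametric_integral_of_continuous (μ := ν) (X := Vec d)
    (f := fun y x : Vec d => Real.exp (inner ℝ y x) • x) (by fun_prop) hK
  rw [restrict_eq_self_of_compl_null h] at this
  exact ((continuous_integral_exp_inner hK h).inv₀
    fun y => (integral_exp_inner_pos hK h y).ne').smul this

lemma continuous_logMGF [IsProbabilityMeasure ν] (hK : IsCompact K) (h : ν Kᶜ = 0) :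
    Continuous (logMGF ν) :=
  (continuous_integral_exp_inner hK h).log fun y => (integral_exp_inner_pos hK h y).ne'

/-- Jensen's inequality for the tilted law: factor out $e^b$, with $b$ the tilted mean of $\langle
y'-y,\cdot\rangle$, and apply $e^s\ge 1+s$ to the centred exponent, whose linear term integrates to
zero. -/
lemma logMGF_add_inner_tiltedMean_le [IsProbabilityMeasure ν] (hK : IsCompact K) (h : ν Kᶜ = 0)
    (y y' : Vec d) : logMGF ν y + inner ℝ (y' - y) (tiltedMean ν y) ≤ logMGF ν y' := by
  have hM := integral_exp_inner_pos hK h y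
  have hM' := integral_exp_inner_pos hK h y'
  set M := ∫ x, Real.exp (inner ℝ y x) ∂ν with hMdef
  set b := inner ℝ (y' - y) (tiltedMean ν y) with hb
  have hV : inner ℝ (y' - y) (∫ x, Real.exp (inner ℝ y x) • x ∂ν) = M * b := by
    rw [hb, tiltedMean, inner_smul_right, ← hMdef, mul_inv_cancel_left₀ hM.ne']
  have hint : Integrable (fun x : Vec d => Real.exp (inner ℝ y x)) ν :=
    integrable_of_continuous_of_compact hK h (by fun_prop)
  have hintV : Integrable (fun x : Vec d => Real.exp (inner ℝ y x) • x) ν :=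
    integrable_of_continuous_of_compact hK h (by fun_prop)
  have key : Real.exp b * M ≤ ∫ x, Real.exp (inner ℝ y' x) ∂ν := by
    have h1 : ∫ x, (Real.exp b * ((1 - b) * Real.exp (inner ℝ y x) +
        inner ℝ (y' - y) (Real.exp (inner ℝ y x) • x))) ∂ν = Real.exp b * M := by
      rw [integral_const_mul, integral_add (hint.const_mul _) (hintV.const_inner _),
        integral_const_mul, integral_inner hintV, hV, ← hMdef]
      ring
    rw [← h1]
    refine integral_mono (((hint.const_mul _).add (hintV.const_inner _)).const_mul _)
      (integrable_of_continuous_of_compact hK h (by fun_prop)) fun x => ?_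
    have h2 : Real.exp (inner ℝ y' x) =
        Real.exp b * (Real.exp (inner ℝ y x) * Real.exp (inner ℝ (y' - y) x - b)) := by
      rw [← Real.exp_add, ← Real.exp_add, inner_sub_left]; ring_nf
    have h3 := Real.add_one_le_exp (inner ℝ (y' - y) x - b)
    simp only [h2, inner_smul_right]
    have h4 := mul_le_mul_of_nonneg_left h3 (Real.exp_pos (inner ℝ y x)).le
    refine mul_le_mul_of_nonneg_left ?_ (Real.exp_pos b).le
    linarith
  have := Real.log_le_log (by positivity) key
  rw [Real.log_mul (Real.exp_pos b).ne' hM.ne', Real.log_exp] at this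
  rw [logMGF, logMGF, ← hMdef]
  linarith

lemma logMGF_convex [IsProbabilityMeasure ν] (hK : IsCompact K) (h : ν Kᶜ = 0)
    (y y' : Vec d) {t : ℝ} (h0 : 0 ≤ t) (h1 : t ≤ 1) :
    logMGF ν (t • y + (1 - t) • y') ≤ t * logMGF ν y + (1 - t) * logMGF ν y' := by
  set w := t • y + (1 - t) • y' with hw
  have e1 := mul_le_mul_of_nonneg_left (logMGF_add_inner_tiltedMean_le hK h w y) h0
  have e2 := mul_le_mul_of_nonneg_left (logMGF_add_inner_tiltedMean_le hK h w y')
    (sub_nonneg.2 h1)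
  have e3 : t * inner ℝ (y - w) (tiltedMean ν w) + (1 - t) * inner ℝ (y' - w) (tiltedMean ν w)
      = 0 := by
    rw [← real_inner_smul_left, ← real_inner_smul_left, ← inner_add_left]
    have : t • (y - w) + (1 - t) • (y' - w) = 0 := by rw [hw]; module
    rw [this, inner_zero_left]
  linarith

/-- The tangent inequalities at $y$ and at $y'$ squeeze the remainder between $0$ and $\langle
\nabla L(y')-\nabla L(y),y'-y\rangle$. Continuity of the tilted mean then suffices, with no
differentiation under the integral. -/
lemma hasGradientAt_logMGF [IsProbabilityMeasure ν] (hK : IsCompact K) (h : ν Kᶜ = 0)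
    (y : Vec d) : HasGradientAt (logMGF ν) (tiltedMean ν y) y := by
  rw [hasGradientAt_iff_isLittleO, Asymptotics.isLittleO_iff]
  intro c hc
  have hcont := (continuous_tiltedMean hK h).tendsto y
  filter_upwards [Metric.tendsto_nhds.1 hcont c hc] with y' hy'
  have e1 := logMGF_add_inner_tiltedMean_le hK h y y'
  have e2 := logMGF_add_inner_tiltedMean_le hK h y' y
  rw [real_inner_comm] at e1
  have e3 : inner ℝ (y - y') (tiltedMean ν y') = - inner ℝ (tiltedMean ν y') (y' - y) := by
    rw [real_inner_comm, ← inner_neg_right, neg_sub]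
  rw [Real.norm_of_nonneg (by linarith)]
  calc logMGF ν y' - logMGF ν y - inner ℝ (tiltedMean ν y) (y' - y)
      ≤ inner ℝ (tiltedMean ν y' - tiltedMean ν y) (y' - y) := by
        rw [inner_sub_left]; linarith
    _ ≤ ‖tiltedMean ν y' - tiltedMean ν y‖ * ‖y' - y‖ := real_inner_le_norm _ _
    _ ≤ c * ‖y' - y‖ := by
        gcongr
        rw [← dist_eq_norm]; exact hy'.le

/-- A point whose tilting minimizes `y ↦ L_ν(y) - ⟨y, x⟩` has tilted mean `x`. -/
lemma tiltedMean_eq_of_forall_le [IsProbabilityMeasure ν] (hK : IsCompact K) (h : ν Kᶜ = 0)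
    {w x : Vec d} (hw : ∀ y, logMGF ν w - inner ℝ w x ≤ logMGF ν y - inner ℝ y x) :
    tiltedMean ν w = x := by
  have hmin : IsLocalMin (fun y => logMGF ν y - inner ℝ y x) w :=
    Filter.Eventually.of_forall hw
  have hd := (hasGradientAt_logMGF hK h w).hasFDerivAt
  have hi : HasFDerivAt (fun y : Vec d => inner ℝ y x) (innerSL ℝ x) w := by
    have := (innerSL ℝ x).hasFDerivAt (x := w)
    refine this.congr_of_eventuallyEq (Filter.Eventually.of_forall fun y => ?_)
    simp [real_inner_comm]
  have h0 := hmin.hasFDerivAt_eq_zero (hd.sub hi)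
  refine ext_inner_right ℝ fun v => ?_
  have := DFunLike.congr_fun h0 v
  simpa [sub_eq_zero] using this

/-! ### Relative entropy and the MEM function -/

/-- The Donsker–Varadhan inequality for linear functionals. -/
lemma inner_sub_logMGF_le_klDiv [IsProbabilityMeasure ν] (hK : IsCompact K) (h : ν Kᶜ = 0)
    (Q : Measure (Vec d)) [IsProbabilityMeasure Q] (hQ : Q Kᶜ = 0) (y : Vec d) :
    ((inner ℝ y (∫ x, x ∂Q) - logMGF ν y : ℝ) : EReal) ≤
      (InformationTheory.klDiv Q ν : EReal) := by
  by_cases htop : InformationTheory.klDiv Q ν = ∞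
  · simp [htop]
  obtain ⟨hac, hint⟩ := InformationTheory.klDiv_ne_top_iff.1 htop
  have hexp : Integrable (fun x : Vec d => Real.exp (inner ℝ y x)) ν :=
    integrable_of_continuous_of_compact hK h (by fun_prop)
  have hlin : Integrable (fun x : Vec d => (inner ℝ y x : ℝ)) Q :=
    integrable_of_continuous_of_compact hK hQ (by fun_prop)
  have hid : Integrable (fun x : Vec d => x) Q :=
    integrable_of_continuous_of_compact hK hQ (by fun_prop)
  have := isProbabilityMeasure_tilted hexp
  have hac' : Q ≪ ν.tilted fun x => inner ℝ y x := hac.trans (absolutelyContinuous_tilted hexp)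
  -- $\mathrm{KL}(Q\,\|\,\nu)$ minus the left-hand side is the divergence of $Q$ from the tilted
  -- measure, which is nonnegative.
  have h1 := integral_llr_tilted_right hac hlin hexp hint
  have h2 := InformationTheory.toReal_klDiv_of_measure_eq hac' (by simp)
  have h3 := InformationTheory.toReal_klDiv_of_measure_eq hac (by simp)
  have h4 : 0 ≤ (InformationTheory.klDiv Q (ν.tilted fun x => inner ℝ y x)).toReal :=
    ENNReal.toReal_nonneg
  rw [integral_inner hid] at h1
  rw [← EReal.coe_ennreal_toReal htop, EReal.coe_le_coe_iff, logMGF]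
  linarith

lemma inner_sub_logMGF_le_memFun [IsProbabilityMeasure ν] (hK : IsCompact K) (h : ν Kᶜ = 0)
    (x y : Vec d) : ((inner ℝ y x - logMGF ν y : ℝ) : EReal) ≤ memFun K ν x := by
  -- The infimum lives in `ℝ≥0∞`, so the possibly negative lower bound is replaced by its positive
  -- part.
  refine (EReal.coe_le_coe_iff.2 (Real.le_coe_toNNReal _)).trans ?_
  change ((ENNReal.ofReal _ : ℝ≥0∞) : EReal) ≤ _
  refine EReal.coe_ennreal_le_coe_ennreal_iff.2 (le_iInf₂ fun Q hQ => ?_)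
  obtain ⟨hQ1, hQ2, rfl⟩ := hQ
  have := inner_sub_logMGF_le_klDiv hK h Q hQ2 y
  by_cases htop : InformationTheory.klDiv Q ν = ∞
  · simp [htop]
  refine ENNReal.ofReal_le_of_le_toReal ?_
  rwa [← EReal.coe_ennreal_toReal htop, EReal.coe_le_coe_iff] at this

/-- The tilted measure is itself a competitor, with log-density $\langle y,\cdot\rangle-L_\nu(y)$.
-/
lemma memFun_tiltedMean_le [IsProbabilityMeasure ν] (hK : IsCompact K) (h : ν Kᶜ = 0)
    (y : Vec d) :
    memFun K ν (tiltedMean ν y) ≤ ((inner ℝ y (tiltedMean ν y) - logMGF ν y : ℝ) : EReal) := by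
  have hexp : Integrable (fun x : Vec d => Real.exp (inner ℝ y x)) ν :=
    integrable_of_continuous_of_compact hK h (by fun_prop)
  set Q := ν.tilted fun x => inner ℝ y x with hQdef
  have hQ : IsProbabilityMeasure Q := isProbabilityMeasure_tilted hexp
  have hQν : Q ≪ ν := tilted_absolutelyContinuous _ _
  have hQK : Q Kᶜ = 0 := hQν h
  have hmean : ∫ x, x ∂Q = tiltedMean ν y := by
    rw [hQdef, integral_tilted, tiltedMean, ← integral_smul]
    refine integral_congr_ae (Filter.Eventually.of_forall fun x => ?_)
    simp only [smul_smul, div_eq_inv_mul]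
  have hlinQ : Integrable (fun x : Vec d => (inner ℝ y x : ℝ)) Q :=
    integrable_of_continuous_of_compact hK hQK (by fun_prop)
  have hidQ : Integrable (fun x : Vec d => x) Q :=
    integrable_of_continuous_of_compact hK hQK (by fun_prop)
  have hllr : llr Q ν =ᵐ[Q] fun x => inner ℝ y x - logMGF ν y :=
    hQν.ae_le (log_rnDeriv_tilted_left_self hexp)
  have hint : Integrable (llr Q ν) Q :=
    (hlinQ.sub (integrable_const (logMGF ν y))).congr hllr.symm
  have htop := InformationTheory.klDiv_ne_top hQν hint
  have hval : (InformationTheory.klDiv Q ν).toReal = inner ℝ y (tiltedMean ν y) - logMGF ν y := by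
    rw [InformationTheory.toReal_klDiv_of_measure_eq hQν (by simp), integral_congr_ae hllr,
      integral_sub hlinQ (integrable_const _), integral_inner hidQ, hmean]
    simp
  rw [← hval, EReal.coe_ennreal_toReal htop]
  exact EReal.coe_ennreal_le_coe_ennreal_iff.2 (iInf₂_le Q ⟨hQ, hQK, hmean⟩)

end CompactSupport

/-! ### Conjugates of proper lower semicontinuous convex functions -/

section Conjugate

variable {m : ℕ} {g : Vec m → EReal}

lemma Proper.exists_le_coe (hg : Proper g) : ∃ (x : Vec m) (r : ℝ), g x ≤ r := by
  obtain ⟨x, hx⟩ := hg.1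
  exact ⟨x, (g x).toReal, EReal.le_coe_toReal (ne_of_lt hx)⟩

lemma conjugate_le_coe_iff (hg : Proper g) (u : Vec m) (a : ℝ) :
    conjugate g u ≤ (a : EReal) ↔ ∀ (x : Vec m) (r : ℝ), g x ≤ r → inner ℝ x u ≤ a + r := by
  rw [conjugate, iSup_le_iff]
  refine forall_congr' fun x => ?_
  have hbot := hg.2 x
  induction hgx : g x with
  | bot => simp [hgx] at hbot
  | top => simp
  | coe s =>
    rw [← EReal.coe_sub, EReal.coe_le_coe_iff]
    refine ⟨fun h r hr => ?_, fun h => ?_⟩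
    · have := EReal.coe_le_coe_iff.1 hr
      linarith
    · linarith [h s le_rfl]

lemma epigraph_convex (hg : ConvexFun g) : Convex ℝ {q : Vec m × ℝ | g q.1 ≤ (q.2 : EReal)} := by
  rw [convex_iff_forall_pos]
  rintro ⟨x, r⟩ hx ⟨y, s⟩ hy a b ha hb hab
  simp only [Set.mem_ofPred_eq] at hx hy
  obtain rfl : b = 1 - a := by linarith
  have h := hg x (hx.trans_lt (EReal.coe_lt_top r)) y (hy.trans_lt (EReal.coe_lt_top s)) a ha
    (by linarith)
  refine h.trans ?_
  have h1 : (a : EReal) * g x ≤ ((a * r : ℝ) : EReal) := by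
    rw [EReal.coe_mul]
    exact mul_le_mul_of_nonneg_left hx (EReal.coe_nonneg.2 ha.le)
  have h2 : ((1 - a : ℝ) : EReal) * g y ≤ (((1 - a) * s : ℝ) : EReal) := by
    rw [EReal.coe_mul]
    exact mul_le_mul_of_nonneg_left hy (EReal.coe_nonneg.2 hb.le)
  simpa [EReal.coe_add] using add_le_add h1 h2

lemma epigraph_isClosed (hg : LowerSemicontinuous g) :
    IsClosed {q : Vec m × ℝ | g q.1 ≤ (q.2 : EReal)} := by
  have := lowerSemicontinuous_iff_isClosed_epigraph.1 hg
  exact this.preimage (f := fun q : Vec m × ℝ => (q.1, (q.2 : EReal)))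
    (continuous_fst.prodMk (continuous_coe_real_ereal.comp continuous_snd))

/-- Hahn–Banach separates $(p,r)$ from the closed convex epigraph. The vertical coefficient $\beta$
cannot be positive because the epigraph is unbounded upwards. -/
lemma exists_separating (hp : Proper g) (hl : LowerSemicontinuous g) (hc : ConvexFun g)
    {p : Vec m} {r : ℝ} (hr : (r : EReal) < g p) :
    ∃ (v : Vec m) (β c : ℝ), β ≤ 0 ∧ (∀ (x : Vec m) (s : ℝ), g x ≤ s → inner ℝ x v + β * s < c) ∧
      c < inner ℝ p v + β * r := by
  obtain ⟨f, c, hf, hfp⟩ := geometric_hahn_banach_closed_point (epigraph_convex hc)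
    (epigraph_isClosed hl) (x := (p, r)) (by simpa using hr)
  set v := (InnerProductSpace.toDual ℝ (Vec m)).symm (f.comp (.inl ℝ (Vec m) ℝ)) with hv
  have hfe : ∀ (x : Vec m) (s : ℝ), f (x, s) = inner ℝ x v + f (0, 1) * s := by
    intro x s
    have h1 : ((x, s) : Vec m × ℝ) = (x, 0) + s • ((0, 1) : Vec m × ℝ) := by simp
    rw [h1, map_add, map_smul, real_inner_comm, hv, InnerProductSpace.toDual_symm_apply]
    simp [mul_comm]
  have hf' : ∀ (x : Vec m) (s : ℝ), g x ≤ s → inner ℝ x v + f (0, 1) * s < c := fun x s hx => by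
    rw [← hfe]; exact hf (x, s) hx
  refine ⟨v, f (0, 1), c, ?_, hf', by rwa [← hfe]⟩
  by_contra! hpos
  obtain ⟨x, s, hx⟩ := hp.exists_le_coe
  have h1 := hf' x (max s ((c - inner ℝ x v) / f (0, 1)))
    (hx.trans (EReal.coe_le_coe_iff.2 (le_max_left _ _)))
  have h2 := mul_le_mul_of_nonneg_left (le_max_right s ((c - inner ℝ x v) / f (0, 1))) hpos.le
  rw [mul_div_cancel₀ _ hpos.ne'] at h2
  linarith

lemma affine_minorant_of_neg {p v : Vec m} {r β c : ℝ} (hβ : β < 0)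
    (h1 : ∀ (x : Vec m) (s : ℝ), g x ≤ s → inner ℝ x v + β * s < c)
    (h2 : c < inner ℝ p v + β * r) :
    ∃ (u : Vec m) (b : ℝ), (∀ (x : Vec m) (s : ℝ), g x ≤ s → inner ℝ x u - b ≤ s) ∧
      r < inner ℝ p u - b := by
  refine ⟨(-β)⁻¹ • v, (-β)⁻¹ * c, fun x s hx => ?_, ?_⟩
  · rw [real_inner_smul_right, ← mul_sub, inv_mul_le_iff₀ (by linarith)]
    linarith [h1 x s hx]
  · rw [real_inner_smul_right, ← mul_sub, lt_inv_mul_iff₀ (by linarith)]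
    linarith

/-- A proper lower semicontinuous convex function is the supremum of its affine minorants. -/
lemma exists_affine_minorant (hp : Proper g) (hl : LowerSemicontinuous g) (hc : ConvexFun g)
    {p : Vec m} {r : ℝ} (hr : (r : EReal) < g p) :
    ∃ (u : Vec m) (b : ℝ), (∀ (x : Vec m) (s : ℝ), g x ≤ s → inner ℝ x u - b ≤ s) ∧
      r < inner ℝ p u - b := by
  obtain ⟨v, β, c, hβ, h1, h2⟩ := exists_separating hp hl hc hr
  rcases hβ.lt_or_eq with hβ | rfl
  · exact affine_minorant_of_neg hβ h1 h2
  obtain ⟨p₀, s₀, hp₀⟩ := hp.exists_le_coe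
  obtain ⟨r₀, -, hr₀⟩ := EReal.lt_iff_exists_real_btwn.1 (hp.2 p₀)
  obtain ⟨u, b, hub, -⟩ : ∃ (u : Vec m) (b : ℝ),
      (∀ (x : Vec m) (s : ℝ), g x ≤ s → inner ℝ x u - b ≤ s) ∧ r₀ < inner ℝ p₀ u - b := by
    -- Over a point of the domain the separating hyperplane cannot be vertical, so some affine
    -- minorant exists.
    obtain ⟨v', β', c', hβ', h1', h2'⟩ := exists_separating hp hl hc hr₀
    refine affine_minorant_of_neg (lt_of_le_of_ne hβ' ?_) h1' h2'
    rintro rfl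
    have := h1' p₀ s₀ hp₀
    linarith
  -- For a vertical hyperplane, $\langle\cdot,v\rangle-c$ is negative on the domain and positive at
  -- $p$. A large multiple of it lifts the minorant above $r$ at $p$.
  obtain ⟨k, hk⟩ := exists_nat_gt ((r - (inner ℝ p u - b)) / (inner ℝ p v - c))
  rw [div_lt_iff₀ (by linarith)] at hk
  refine ⟨u + (k : ℝ) • v, b + k * c, fun x s hx => ?_, ?_⟩
  · have e1 := hub x s hx
    have e2 := mul_le_mul_of_nonneg_left (h1 x s hx).le (Nat.cast_nonneg (α := ℝ) k)
    rw [inner_add_right, real_inner_smul_right]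
    linarith
  · rw [inner_add_right, real_inner_smul_right]
    linarith

end Conjugate

/-! ### Duality -/

section Duality

variable {m d : ℕ} {g : Vec m → EReal} {C : Matrix (Fin m) (Fin d) ℝ} {α : ℝ}
  {K : Set (Vec d)} {ν : Measure (Vec d)}

lemma inner_toEuclideanLin_transpose (C : Matrix (Fin m) (Fin d) ℝ) (z : Vec m) (x : Vec d) :
    inner ℝ (Matrix.toEuclideanLin Cᵀ z) x = inner ℝ (Matrix.toEuclideanLin C x) z := by
  have h := LinearMap.adjoint_inner_left (Matrix.toEuclideanLin C) x z
  rw [← Matrix.toEuclideanLin_conjTranspose_eq_adjoint, Matrix.conjTranspose_eq_transpose_of_trivial]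
    at h
  rw [h, real_inner_comm]

/-- Turns sublevel sets into real inequalities indexed by epigraph points of $g$, each continuous in
$z$. Semicontinuity, convexity and limits are all read off this form, without `EReal` arithmetic. -/
lemma dualObj_le_coe_iff (hg : Proper g) (hα : 0 < α) (z : Vec m) (a : ℝ) :
    dualObj g C α ν z ≤ (a : EReal) ↔ ∀ (x : Vec m) (r : ℝ), g x ≤ r →
      logMGF ν (Matrix.toEuclideanLin Cᵀ z) - inner ℝ x z ≤ a + α * r := by
  set l := logMGF ν (Matrix.toEuclideanLin Cᵀ z) with hl
  have h1 : dualObj g C α ν z ≤ (a : EReal) ↔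
      conjugate g (-(α⁻¹ • z)) ≤ (((a - l) / α : ℝ) : EReal) := by
    rw [dualObj, ← hl]
    induction conjugate g (-(α⁻¹ • z)) with
    | bot => simp [EReal.coe_mul_bot_of_pos hα]
    | top => simp [EReal.coe_mul_top_of_pos hα]
    | coe s =>
      rw [← EReal.coe_mul, ← EReal.coe_add, EReal.coe_le_coe_iff, EReal.coe_le_coe_iff,
        le_div_iff₀ hα]
      constructor <;> intro h <;> linarith
  rw [h1, conjugate_le_coe_iff hg]
  refine forall_congr' fun x => forall_congr' fun r => imp_congr_right fun _ => ?_
  rw [inner_neg_right, real_inner_smul_right, ← mul_le_mul_iff_right₀ hα, mul_add,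
    mul_div_cancel₀ _ hα.ne', mul_neg, mul_inv_cancel_left₀ hα.ne']
  constructor <;> intro h <;> linarith

lemma bot_lt_dualObj (hg : Proper g) (hα : 0 < α) (z : Vec m) : ⊥ < dualObj g C α ν z := by
  obtain ⟨x, r, hx⟩ := hg.exists_le_coe
  by_contra h
  have h0 : dualObj g C α ν z = ⊥ := not_bot_lt_iff.1 h
  have := (dualObj_le_coe_iff (C := C) (ν := ν) hg hα z
    (logMGF ν (Matrix.toEuclideanLin Cᵀ z) - inner ℝ x z - α * r - 1)).1 (h0 ▸ bot_le) x r hx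
  linarith

lemma exists_dualObj_le_coe (hp : Proper g) (hl : LowerSemicontinuous g) (hc : ConvexFun g)
    (hα : 0 < α) : ∃ (z : Vec m) (a : ℝ), dualObj g C α ν z ≤ a := by
  obtain ⟨p, s, -⟩ := hp.exists_le_coe
  obtain ⟨r, -, hr⟩ := EReal.lt_iff_exists_real_btwn.1 (hp.2 p)
  obtain ⟨u, b, hub, -⟩ := exists_affine_minorant hp hl hc hr
  refine ⟨-(α • u), α * b + logMGF ν (Matrix.toEuclideanLin Cᵀ (-(α • u))), ?_⟩
  rw [dualObj_le_coe_iff hp hα]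
  intro x r hx
  have := mul_le_mul_of_nonneg_left (hub x r hx) hα.le
  rw [inner_neg_right, real_inner_smul_right]
  linarith

lemma continuous_logMGF_transpose [IsProbabilityMeasure ν] (hK : IsCompact K) (h : ν Kᶜ = 0) :
    Continuous fun z : Vec m => logMGF ν (Matrix.toEuclideanLin Cᵀ z) :=
  (continuous_logMGF hK h).comp (LinearMap.continuous_of_finiteDimensional _)

lemma lowerSemicontinuous_dualObj (hg : Proper g) (hα : 0 < α) [IsProbabilityMeasure ν]
    (hK : IsCompact K) (h : ν Kᶜ = 0) : LowerSemicontinuous (dualObj g C α ν) := by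
  rw [lowerSemicontinuous_iff_isClosed_preimage]
  intro y
  have hL := continuous_logMGF_transpose (C := C) hK h
  induction y with
  | bot =>
    convert! isClosed_empty
    ext z
    simpa using (bot_lt_dualObj hg hα z).ne'
  | top => simp
  | coe a =>
    have : dualObj g C α ν ⁻¹' Set.Iic (a : EReal) = ⋂ (x : Vec m) (r : ℝ) (_ : g x ≤ r),
        {z | logMGF ν (Matrix.toEuclideanLin Cᵀ z) - inner ℝ x z ≤ a + α * r} := by
      ext z
      simp [dualObj_le_coe_iff hg hα]
    rw [this]
    exact isClosed_iInter fun x => isClosed_iInter fun r => isClosed_iInter fun _ =>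
      isClosed_le (hL.sub (by fun_prop)) continuous_const

/-- Perturbed weak duality. -/
lemma neg_inner_le_of_dualObj_le (hg : Proper g) (hα : 0 < α) [IsProbabilityMeasure ν]
    (hK : IsCompact K) (h : ν Kᶜ = 0) {z u : Vec m} {x : Vec d} {a r s : ℝ}
    (hz : dualObj g C α ν z ≤ a) (hr : g (Matrix.toEuclideanLin C x + u) ≤ r)
    (hs : memFun K ν x ≤ s) : -inner ℝ u z ≤ a + α * r + s := by
  have h1 := (dualObj_le_coe_iff hg hα z a).1 hz _ r hr
  have h2 := EReal.coe_le_coe_iff.1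
    ((inner_sub_logMGF_le_memFun hK h x (Matrix.toEuclideanLin Cᵀ z)).trans hs)
  rw [inner_add_left] at h1
  rw [inner_toEuclideanLin_transpose] at h2
  linarith

/-- For each direction $v$, the interior condition writes some $-tv$, $t>0$, as $y-Cx$ with both
terms finite. Perturbed weak duality then bounds $\langle v,z\rangle$ on the sublevel set, and the
directions $\pm e_i$ suffice. -/
lemma isBounded_sublevel_dualObj (hg : Proper g) (hα : 0 < α) [IsProbabilityMeasure ν]
    (hK : IsCompact K) (h : ν Kᶜ = 0)
    (hdom : (0 : Vec m) ∈ interior (dom g - Matrix.toEuclideanLin C '' dom (memFun K ν))) (a : ℝ) :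
    Bornology.IsBounded {z | dualObj g C α ν z ≤ (a : EReal)} := by
  have hdir : ∀ v : Vec m, ∃ b : ℝ, ∀ z, dualObj g C α ν z ≤ (a : EReal) → inner ℝ v z ≤ b := by
    intro v
    have ht : Tendsto (fun t : ℝ => -(t • v)) (𝓝[>] 0) (𝓝 0) := by
      have : Continuous fun t : ℝ => -(t • v) := by fun_prop
      simpa using (this.tendsto 0).mono_left nhdsWithin_le_nhds
    obtain ⟨t, htmem, ht0⟩ := ((ht.eventually (mem_interior_iff_mem_nhds.1 hdom)).and
      self_mem_nhdsWithin).exists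
    obtain ⟨y, hy, _, ⟨x, hx, rfl⟩, hyx⟩ := htmem
    refine ⟨t⁻¹ * (a + α * (g y).toReal + (memFun K ν x).toReal), fun z hz => ?_⟩
    rw [le_inv_mul_iff₀ ht0, ← real_inner_smul_left]
    have := neg_inner_le_of_dualObj_le hg hα hK h (u := -(t • v)) (x := x) hz
      (r := (g y).toReal) (s := (memFun K ν x).toReal)
      (by rw [← hyx, add_sub_cancel]; exact EReal.le_coe_toReal (ne_of_lt hy))
      (EReal.le_coe_toReal (ne_of_lt hx))
    rwa [inner_neg_left, neg_neg] at this
  choose b hb using hdir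
  let e := EuclideanSpace.basisFun (Fin m) ℝ
  rw [isBounded_iff_forall_norm_le]
  refine ⟨∑ i, max (b (e i)) (b (-e i)), fun z hz => ?_⟩
  rw [← e.sum_repr z]
  refine (norm_sum_le _ _).trans (Finset.sum_le_sum fun i _ => ?_)
  rw [norm_smul, e.norm_eq_one, mul_one, Real.norm_eq_abs, e.repr_apply_apply]
  refine abs_le'.2 ⟨(hb _ z hz).trans (le_max_left _ _), ?_⟩
  rw [← inner_neg_left]
  exact (hb _ z hz).trans (le_max_right _ _)

lemma exists_mem_argmin_dualObj (hp : Proper g) (hl : LowerSemicontinuous g) (hc : ConvexFun g)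
    (hα : 0 < α) [IsProbabilityMeasure ν] (hK : IsCompact K) (h : ν Kᶜ = 0)
    (hdom : (0 : Vec m) ∈ interior (dom g - Matrix.toEuclideanLin C '' dom (memFun K ν))) :
    (argmin (dualObj g C α ν)).Nonempty := by
  obtain ⟨z₀, a, ha⟩ := exists_dualObj_le_coe (C := C) (ν := ν) hp hl hc hα
  have hlsc := lowerSemicontinuous_dualObj (C := C) hp hα hK h
  have hcomp : IsCompact {z | dualObj g C α ν z ≤ (a : EReal)} :=
    Metric.isCompact_of_isClosed_isBounded
      (lowerSemicontinuous_iff_isClosed_preimage.1 hlsc (a : EReal))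
      (isBounded_sublevel_dualObj hp hα hK h hdom a)
  obtain ⟨z, hz, hmin⟩ := (hlsc.lowerSemicontinuousOn _).exists_isMinOn ⟨z₀, ha⟩ hcomp
  refine ⟨z, show dualObj g C α ν z ≤ _ from le_iInf fun y => ?_⟩
  rcases le_total (dualObj g C α ν y) a with hy | hy
  · exact hmin hy
  · exact le_trans hz hy

lemma primalObj_le (hα : 0 < α) {x : Vec d} {r s : ℝ} (hr : g (Matrix.toEuclideanLin C x) ≤ r)
    (hs : memFun K ν x ≤ s) : primalObj g C α K ν x ≤ ((α * r + s : ℝ) : EReal) := by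
  rw [primalObj, EReal.coe_add, EReal.coe_mul]
  exact add_le_add (mul_le_mul_of_nonneg_left hr (EReal.coe_nonneg.2 hα.le)) hs

lemma exists_of_primalObj_le (hg : Proper g) (hα : 0 < α) {x : Vec d} {a : ℝ}
    (hx : primalObj g C α K ν x ≤ a) :
    ∃ r s : ℝ, g (Matrix.toEuclideanLin C x) ≤ r ∧ memFun K ν x ≤ s ∧ α * r + s ≤ a := by
  rw [primalObj] at hx
  have hbot := hg.2 (Matrix.toEuclideanLin C x)
  have hk : 0 ≤ memFun K ν x := EReal.coe_ennreal_nonneg _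
  induction h1 : g (Matrix.toEuclideanLin C x) with
  | bot => simp [h1] at hbot
  | top =>
    rw [h1, EReal.coe_mul_top_of_pos hα,
      EReal.top_add_of_ne_bot (ne_bot_of_le_ne_bot (by simp) hk)] at hx
    simp at hx
  | coe r =>
    rw [h1, ← EReal.coe_mul] at hx
    induction h2 : memFun K ν x with
    | bot => simp [h2] at hk
    | top => simp [h2, -EReal.coe_mul] at hx
    | coe s => exact ⟨r, s, le_rfl, le_rfl, by rw [h2] at hx; exact_mod_cast hx⟩

/-- A dual minimizer yields a finite value of `g` at the associated primal point, matching the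
dual optimal value. -/
lemma g_le_of_dual_min (hp : Proper g) (hl : LowerSemicontinuous g) (hc : ConvexFun g)
    (hα : 0 < α) [IsProbabilityMeasure ν] (hK : IsCompact K) (h : ν Kᶜ = 0) {zbar : Vec m} {a : ℝ}
    (ha : dualObj g C α ν zbar ≤ a)
    (hmin : ∀ (z : Vec m) (b : ℝ), dualObj g C α ν z ≤ b → a ≤ b) {w xbar : Vec d}
    (hw : w = Matrix.toEuclideanLin Cᵀ zbar) (hx : xbar = tiltedMean ν w) :
    g (Matrix.toEuclideanLin C xbar) ≤ ((α⁻¹ * (logMGF ν w - a - inner ℝ w xbar) : ℝ) : EReal) := by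
  by_contra! hlt
  obtain ⟨u, b, hub, hlt'⟩ := exists_affine_minorant hp hl hc hlt
  rw [inv_mul_lt_iff₀ hα] at hlt'
  -- Move from $\bar z$ towards $-\alpha u$, where $\alpha g^*(-\cdot/\alpha)\le\alpha b$.
  -- Minimality along the segment, divided by $t$ and taken to $t\to0^+$, contradicts the choice of
  -- $u$.
  set v : Vec m := -(α • u) - zbar with hv
  set Cv := Matrix.toEuclideanLin Cᵀ v with hCv
  have hineq : ∀ t : ℝ, 0 < t → t < 1 →
      a - logMGF ν w - α * b ≤ inner ℝ Cv (tiltedMean ν (w + t • Cv)) := by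
    intro t ht0 ht1
    have hCz : Matrix.toEuclideanLin Cᵀ (zbar + t • v) = w + t • Cv := by
      rw [map_add, map_smul, hw]
    have h1 : dualObj g C α ν (zbar + t • v) ≤
        (((1 - t) * (a - logMGF ν w) + t * (α * b) + logMGF ν (w + t • Cv) : ℝ) : EReal) := by
      rw [dualObj_le_coe_iff hp hα]
      intro x s hxs
      have e1 := mul_le_mul_of_nonneg_left ((dualObj_le_coe_iff hp hα _ _).1 ha x s hxs)
        (sub_nonneg.2 ht1.le)
      have e2 := mul_le_mul_of_nonneg_left
        (mul_le_mul_of_nonneg_left (hub x s hxs) hα.le) ht0.le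
      rw [hCz]
      rw [← hw] at e1
      rw [hv, inner_add_right, real_inner_smul_right, inner_sub_right, inner_neg_right,
        real_inner_smul_right]
      linarith
    have h2 := hmin _ _ h1
    have h3 := logMGF_add_inner_tiltedMean_le hK h (w + t • Cv) w
    have h4 : w - (w + t • Cv) = -(t • Cv) := by abel
    rw [h4, inner_neg_left, real_inner_smul_left] at h3
    have h5 : t * (a - logMGF ν w - α * b) ≤ t * inner ℝ Cv (tiltedMean ν (w + t • Cv)) := by
      linarith
    exact le_of_mul_le_mul_left h5 ht0
  have hlim : Tendsto (fun t : ℝ => inner ℝ Cv (tiltedMean ν (w + t • Cv))) (𝓝[>] 0)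
      (𝓝 (inner ℝ Cv xbar)) := by
    have hcont : Continuous fun t : ℝ => inner ℝ Cv (tiltedMean ν (w + t • Cv)) :=
      continuous_const.inner ((continuous_tiltedMean hK h).comp (by fun_prop))
    have := (hcont.tendsto 0).mono_left (nhdsWithin_le_nhds (s := Set.Ioi 0))
    rwa [zero_smul, add_zero, ← hx] at this
  have hfin : a - logMGF ν w - α * b ≤ inner ℝ Cv xbar := by
    refine ge_of_tendsto hlim ?_
    filter_upwards [Ioo_mem_nhdsGT (zero_lt_one' ℝ)] with t ht using hineq t ht.1 ht.2
  rw [hCv, inner_toEuclideanLin_transpose, hv, inner_sub_right, inner_neg_right,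
    real_inner_smul_right, ← inner_toEuclideanLin_transpose C zbar, ← hw] at hfin
  linarith

/-- Strong duality: a dual minimizer determines the unique primal minimizer. -/
theorem argmin_primalObj_eq (hp : Proper g) (hl : LowerSemicontinuous g) (hc : ConvexFun g)
    (hα : 0 < α) [IsProbabilityMeasure ν] (hK : IsCompact K) (h : ν Kᶜ = 0) {zbar : Vec m}
    (hz : zbar ∈ argmin (dualObj g C α ν)) :
    argmin (primalObj g C α K ν) = {tiltedMean ν (Matrix.toEuclideanLin Cᵀ zbar)} := by
  have hz' : ∀ y, dualObj g C α ν zbar ≤ dualObj g C α ν y := fun y => le_trans hz (iInf_le _ y)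
  obtain ⟨a, ha⟩ : ∃ a : ℝ, dualObj g C α ν zbar = a := by
    obtain ⟨z₀, a₀, ha₀⟩ := exists_dualObj_le_coe (C := C) (ν := ν) hp hl hc hα
    exact ⟨_, (EReal.coe_toReal (ne_of_lt (((hz' z₀).trans ha₀).trans_lt (EReal.coe_lt_top a₀)))
      (bot_lt_dualObj hp hα zbar).ne').symm⟩
  have hmin : ∀ (z : Vec m) (b : ℝ), dualObj g C α ν z ≤ b → a ≤ b := fun z b hb =>
    EReal.coe_le_coe_iff.1 (ha ▸ (hz' z).trans hb)
  have ha' := ha.le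
  set w := Matrix.toEuclideanLin Cᵀ zbar with hw
  have hle : primalObj g C α K ν (tiltedMean ν w) ≤ ((-a : ℝ) : EReal) := by
    have := primalObj_le hα (g_le_of_dual_min hp hl hc hα hK h ha' hmin hw rfl)
      (memFun_tiltedMean_le hK h w)
    rw [mul_inv_cancel_left₀ hα.ne'] at this
    convert! this using 2
    ring
  have hweak : ∀ x, ((-a : ℝ) : EReal) ≤ primalObj g C α K ν x := by
    intro x
    refine EReal.le_of_forall_lt_iff_le.1 fun b hb => ?_
    obtain ⟨r, s, hr, hs, hrs⟩ := exists_of_primalObj_le hp hα hb.le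
    have := neg_inner_le_of_dualObj_le hp hα hK h (u := 0) ha' (by rwa [add_zero]) hs
    rw [inner_zero_left] at this
    exact EReal.coe_le_coe_iff.2 (by linarith)
  refine Set.eq_singleton_iff_unique_mem.2 ⟨hle.trans (le_iInf hweak), fun x hx => ?_⟩
  obtain ⟨r, s, hr, hs, hrs⟩ :=
    exists_of_primalObj_le hp hα ((hx.trans (iInf_le _ (tiltedMean ν w))).trans hle)
  -- At any minimizer $x$ the duality chain is tight, so $w$ minimizes $L_\nu-\langle\cdot,x\rangle$
  -- and stationarity identifies $x$.
  refine (tiltedMean_eq_of_forall_le hK h fun y => ?_).symm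
  have e1 := (dualObj_le_coe_iff hp hα _ _).1 ha' _ r hr
  rw [← hw, ← inner_toEuclideanLin_transpose, ← hw] at e1
  have e2 := EReal.coe_le_coe_iff.1 ((inner_sub_logMGF_le_memFun hK h x y).trans hs)
  linarith

end Duality

/-! ### A uniform strong law of large numbers -/

/-- Almost surely, empirical averages converge simultaneously for all continuous functions on a
compact space, and jointly along convergent sequences of functions. -/
lemma ae_tendsto_average {Ω S E : Type*} [MeasurableSpace Ω] {P : Measure Ω}
    [IsProbabilityMeasure P] [TopologicalSpace S] [CompactSpace S] [T2Space S]
    [SecondCountableTopology S] [MeasurableSpace S] [BorelSpace S]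
    [NormedAddCommGroup E] [NormedSpace ℝ E] [CompleteSpace E] [SecondCountableTopology E]
    [MeasurableSpace E] [BorelSpace E]
    {Y : ℕ → Ω → S} (hY : ∀ i, Measurable (Y i)) (hindep : ProbabilityTheory.iIndepFun Y P)
    (hident : ∀ i, ProbabilityTheory.IdentDistrib (Y i) (Y 0) P P) :
    ∀ᵐ ω ∂P, ∀ (k : ℕ → ℕ) (f : ℕ → C(S, E)) (F : C(S, E)), Tendsto k atTop atTop →
      Tendsto f atTop (𝓝 F) →
      Tendsto (fun j => (k j : ℝ)⁻¹ • ∑ i ∈ Finset.range (k j), f j (Y i ω)) atTop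
        (𝓝 (∫ ω, F (Y 0 ω) ∂P)) := by
  have hint : ∀ F : C(S, E), Integrable (fun ω => F (Y 0 ω)) P := fun F =>
    Integrable.of_bound (F.continuous.measurable.comp (hY 0)).aestronglyMeasurable ‖F‖
      (Eventually.of_forall fun ω => F.norm_coe_le_norm _)
  -- $C(S,E)$ is separable in the uniform norm, so countably many strong laws give a single null
  -- set. The rest is a uniform approximation argument.
  have hdense : ∀ᵐ ω ∂P, ∀ q : ℕ, Tendsto (fun n : ℕ => (n : ℝ)⁻¹ •
      ∑ i ∈ Finset.range n, TopologicalSpace.denseSeq C(S, E) q (Y i ω)) atTop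
      (𝓝 (∫ ω, TopologicalSpace.denseSeq C(S, E) q (Y 0 ω) ∂P)) := by
    refine ae_all_iff.2 fun q => ?_
    set F := TopologicalSpace.denseSeq C(S, E) q
    refine ProbabilityTheory.strong_law_ae (fun i ω => F (Y i ω)) (hint F)
      (fun i j hij => ?_) fun i => (hident i).comp F.continuous.measurable
    exact (hindep.indepFun hij).comp F.continuous.measurable F.continuous.measurable
  filter_upwards [hdense] with ω hω k f F hk hf
  rw [Metric.tendsto_atTop]
  intro ε hε
  obtain ⟨q, hq⟩ := (TopologicalSpace.denseRange_denseSeq C(S, E)).exists_dist_lt F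
    (show 0 < ε / 4 by positivity)
  set G := TopologicalSpace.denseSeq C(S, E) q
  have h1 := Metric.tendsto_atTop.1 ((hω q).comp hk) (ε / 4) (by positivity)
  obtain ⟨N₁, hN₁⟩ := h1
  obtain ⟨N₂, hN₂⟩ := Metric.tendsto_atTop.1 hf (ε / 4) (by positivity)
  refine ⟨max N₁ N₂, fun j hj => ?_⟩
  have hA := hN₁ j (le_of_max_le_left hj)
  have hB := hN₂ j (le_of_max_le_right hj)
  have hfG : dist (f j) G ≤ ε / 2 := by
    linarith [dist_triangle (f j) F G]
  have hC : dist ((k j : ℝ)⁻¹ • ∑ i ∈ Finset.range (k j), f j (Y i ω))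
      ((k j : ℝ)⁻¹ • ∑ i ∈ Finset.range (k j), G (Y i ω)) ≤ ε / 2 := by
    rw [dist_eq_norm, ← smul_sub, ← Finset.sum_sub_distrib, norm_smul, norm_inv,
      Real.norm_natCast]
    have : ‖∑ i ∈ Finset.range (k j), (f j (Y i ω) - G (Y i ω))‖ ≤ k j * (ε / 2) := by
      refine (norm_sum_le_of_le _ (f := fun i => f j (Y i ω) - G (Y i ω))
        (n := fun _ => ε / 2) fun i _ => ?_).trans (by simp)
      rw [← dist_eq_norm]
      exact (ContinuousMap.dist_apply_le_dist _).trans hfG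
    rcases Nat.eq_zero_or_pos (k j) with h0 | h0
    · simp [h0]; positivity
    · rwa [inv_mul_le_iff₀ (by exact_mod_cast h0)]
  have hD : dist (∫ ω, G (Y 0 ω) ∂P) (∫ ω, F (Y 0 ω) ∂P) ≤ ε / 4 := by
    rw [dist_eq_norm, ← integral_sub (hint G) (hint F)]
    have := norm_integral_le_of_norm_le_const (μ := P) (f := fun ω => G (Y 0 ω) - F (Y 0 ω))
      (C := ε / 4) (Eventually.of_forall fun ω => by
        rw [← dist_eq_norm, dist_comm]
        exact (ContinuousMap.dist_apply_le_dist _).trans hq.le)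
    simpa using this
  have hA' : dist ((k j : ℝ)⁻¹ • ∑ i ∈ Finset.range (k j), G (Y i ω))
    (∫ ω, G (Y 0 ω) ∂P) < ε / 4 := hA
  linarith [dist_triangle4 ((k j : ℝ)⁻¹ • ∑ i ∈ Finset.range (k j), f j (Y i ω))
    ((k j : ℝ)⁻¹ • ∑ i ∈ Finset.range (k j), G (Y i ω)) (∫ ω, G (Y 0 ω) ∂P)
    (∫ ω, F (Y 0 ω) ∂P)]

/-! ### Empirical measures -/

section Empirical

variable {d : ℕ} {Ω : Type*} {K : Set (Vec d)} {X : ℕ → Ω → Vec d}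

lemma integral_empirical {E : Type*} [NormedAddCommGroup E] [NormedSpace ℝ E] [CompleteSpace E]
    (n : ℕ) (ω : Ω) (f : Vec d → E) :
    ∫ x, f x ∂(empirical X n ω) = (n : ℝ)⁻¹ • ∑ i ∈ Finset.range n, f (X i ω) := by
  rw [empirical, integral_smul_measure, integral_finsetSum_measure]
  · simp
  · exact fun i _ => integrable_dirac (by simp)

lemma isProbabilityMeasure_empirical {n : ℕ} (hn : n ≠ 0) (ω : Ω) :
    IsProbabilityMeasure (empirical X n ω) := by
  refine ⟨?_⟩
  simp [empirical, ENNReal.inv_mul_cancel, hn]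

lemma empirical_compl_eq_zero (hK : MeasurableSet K) (hX : ∀ i ω, X i ω ∈ K) (n : ℕ) (ω : Ω) :
    empirical X n ω Kᶜ = 0 := by
  simp [empirical, Measure.dirac_apply' _ hK.compl, hX]

/-- Almost surely, log-moment generating functions and tilted means of the empirical measures
converge, jointly in the argument. -/
lemma ae_tendsto_logMGF_tiltedMean [MeasurableSpace Ω] {P : Measure Ω} [IsProbabilityMeasure P]
    (hK : IsCompact K) {μ : Measure (Vec d)} (hX_meas : ∀ i, Measurable (X i))
    (hX_mem : ∀ i ω, X i ω ∈ K) (hX_law : ∀ i, P.map (X i) = μ)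
    (hX_indep : ProbabilityTheory.iIndepFun X P) :
    ∀ᵐ ω ∂P, ∀ (k : ℕ → ℕ) (w : ℕ → Vec d) (w₀ : Vec d), Tendsto k atTop atTop →
      Tendsto w atTop (𝓝 w₀) →
      Tendsto (fun j => logMGF (empirical X (k j) ω) (w j)) atTop (𝓝 (logMGF μ w₀)) ∧
      Tendsto (fun j => tiltedMean (empirical X (k j) ω) (w j)) atTop (𝓝 (tiltedMean μ w₀)) := by
  have : CompactSpace K := isCompact_iff_compactSpace.1 hK
  have hKm : MeasurableSet K := hK.measurableSet
  have hμ : IsProbabilityMeasure μ :=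
    hX_law 0 ▸ Measure.isProbabilityMeasure_map (hX_meas 0).aemeasurable
  have hμK : μ Kᶜ = 0 := by
    rw [← hX_law 0, Measure.map_apply (hX_meas 0) hKm.compl]
    convert! measure_empty (μ := P)
    ext ω
    simp [hX_mem]
  let Y : ℕ → Ω → K := fun i ω => ⟨X i ω, hX_mem i ω⟩
  have hYm : ∀ i, Measurable (Y i) := fun i => (hX_meas i).subtype_mk
  have hYindep : ProbabilityTheory.iIndepFun Y P := by
    rw [ProbabilityTheory.iIndepFun_iff_iIndep] at hX_indep ⊢
    convert! hX_indep using 2 with i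
    change MeasurableSpace.comap (Y i) (MeasurableSpace.comap Subtype.val _) = _
    rw [MeasurableSpace.comap_comp]
    rfl
  have hYident : ∀ i, ProbabilityTheory.IdentDistrib (Y i) (Y 0) P P := by
    refine fun i => ⟨(hYm i).aemeasurable, (hYm 0).aemeasurable, ?_⟩
    have hemb := MeasurableEmbedding.subtype_coe hKm
    have h1 : ∀ i, (P.map (Y i)).map Subtype.val = μ := fun i => by
      rw [Measure.map_map measurable_subtype_coe (hYm i)]
      exact hX_law i
    rw [← hemb.comap_map (P.map (Y i)), ← hemb.comap_map (P.map (Y 0)), h1, h1]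
  -- Currying makes the integrand a uniformly continuous-norm-valued function of $y$: $w_j\to w_0$
  -- yields uniform convergence on $K$.
  let F : C(Vec d, C(K, ℝ)) := ContinuousMap.curry
    ⟨fun q : Vec d × K => Real.exp (inner ℝ q.1 (q.2 : Vec d)), by fun_prop⟩
  let V : C(Vec d, C(K, Vec d)) := ContinuousMap.curry
    ⟨fun q : Vec d × K => Real.exp (inner ℝ q.1 (q.2 : Vec d)) • (q.2 : Vec d), by fun_prop⟩
  have hF : ∀ y, ∫ ω, F y (Y 0 ω) ∂P = ∫ x, Real.exp (inner ℝ y x) ∂μ := fun y => by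
    rw [← hX_law 0, integral_map (hX_meas 0).aemeasurable
      (by fun_prop : Continuous fun x : Vec d => Real.exp (inner ℝ y x)).aestronglyMeasurable]
    rfl
  have hV : ∀ y, ∫ ω, V y (Y 0 ω) ∂P = ∫ x, Real.exp (inner ℝ y x) • x ∂μ := fun y => by
    rw [← hX_law 0, integral_map (hX_meas 0).aemeasurable
      (by fun_prop : Continuous fun x : Vec d => Real.exp (inner ℝ y x) • x).aestronglyMeasurable]
    rfl
  filter_upwards [ae_tendsto_average (E := ℝ) hYm hYindep hYident,
    ae_tendsto_average (E := Vec d) hYm hYindep hYident] with ω h1 h2 k w w₀ hk hw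
  have e1 := h1 k (fun j => F (w j)) (F w₀) hk ((F.continuous.tendsto w₀).comp hw)
  have e2 := h2 k (fun j => V (w j)) (V w₀) hk ((V.continuous.tendsto w₀).comp hw)
  rw [hF] at e1
  rw [hV] at e2
  have e1' : Tendsto (fun j => ∫ x, Real.exp (inner ℝ (w j) x) ∂(empirical X (k j) ω)) atTop
      (𝓝 (∫ x, Real.exp (inner ℝ w₀ x) ∂μ)) := by
    simp_rw [integral_empirical]
    exact e1
  have e2' : Tendsto (fun j => ∫ x, Real.exp (inner ℝ (w j) x) • x ∂(empirical X (k j) ω)) atTop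
      (𝓝 (∫ x, Real.exp (inner ℝ w₀ x) • x ∂μ)) := by
    simp_rw [integral_empirical]
    exact e2
  have hne := (integral_exp_inner_pos hK hμK w₀).ne'
  exact ⟨e1'.log hne, (e1'.inv₀ hne).smul e2'⟩

end Empirical

/-! ### Stability of dual minimizers -/

section Stability

variable {m d : ℕ} {g : Vec m → EReal} {C : Matrix (Fin m) (Fin d) ℝ} {α : ℝ}
  {K : Set (Vec d)} {ν : ℕ → Measure (Vec d)} {μ : Measure (Vec d)}

/-- The lower-limit half of epi-convergence, obtained by passing to the limit in each inequality of
`dualObj_le_coe_iff`. -/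
lemma dualObj_le_of_tendsto (hg : Proper g) (hα : 0 < α)
    (hL : ∀ (k : ℕ → ℕ) (w : ℕ → Vec d) (w₀ : Vec d), Tendsto k atTop atTop →
      Tendsto w atTop (𝓝 w₀) → Tendsto (fun j => logMGF (ν (k j)) (w j)) atTop (𝓝 (logMGF μ w₀)))
    {k : ℕ → ℕ} (hk : Tendsto k atTop atTop) {z : ℕ → Vec m} {z₀ : Vec m}
    (hz : Tendsto z atTop (𝓝 z₀)) {a : ℕ → ℝ} {a₀ : ℝ} (ha : Tendsto a atTop (𝓝 a₀))
    (hle : ∀ᶠ j in atTop, dualObj g C α (ν (k j)) (z j) ≤ a j) : dualObj g C α μ z₀ ≤ a₀ := by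
  rw [dualObj_le_coe_iff hg hα]
  intro x r hx
  have hC : Continuous (Matrix.toEuclideanLin Cᵀ) := LinearMap.continuous_of_finiteDimensional _
  refine le_of_tendsto_of_tendsto ((hL k _ _ hk ((hC.tendsto z₀).comp hz)).sub
    (tendsto_const_nhds.inner hz)) (ha.add_const (α * r)) ?_
  filter_upwards [hle] with j hj using (dualObj_le_coe_iff hg hα _ _).1 hj x r hx

/-- The two objectives differ only in their log-moment terms, so a fixed competitor serves as its
own recovery sequence. -/
lemma dualObj_le_of_dualObj_le (hg : Proper g) (hα : 0 < α) {z : Vec m} {b : ℝ}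
    (hz : dualObj g C α μ z ≤ b) (ν' : Measure (Vec d)) :
    dualObj g C α ν' z ≤ ((b - logMGF μ (Matrix.toEuclideanLin Cᵀ z) +
      logMGF ν' (Matrix.toEuclideanLin Cᵀ z) : ℝ) : EReal) := by
  rw [dualObj_le_coe_iff hg hα] at hz ⊢
  intro x r hx
  linarith [hz x r hx]

/-- Limits of points doing asymptotically as well as every fixed competitor are minimizers. -/
lemma mem_argmin_of_tendsto (hg : Proper g) (hα : 0 < α)
    (hL : ∀ (k : ℕ → ℕ) (w : ℕ → Vec d) (w₀ : Vec d), Tendsto k atTop atTop →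
      Tendsto w atTop (𝓝 w₀) → Tendsto (fun j => logMGF (ν (k j)) (w j)) atTop (𝓝 (logMGF μ w₀)))
    {ε : ℕ → ℝ} (hε : Tendsto ε atTop (𝓝 0)) {z : ℕ → Vec m}
    (hmin : ∀ᶠ n in atTop, IsApproxMin (dualObj g C α (ν n)) (ε n) (z n))
    {k : ℕ → ℕ} (hk : Tendsto k atTop atTop) {z₀ : Vec m}
    (hz : Tendsto (fun j => z (k j)) atTop (𝓝 z₀)) : z₀ ∈ argmin (dualObj g C α μ) := by
  refine show dualObj g C α μ z₀ ≤ _ from le_iInf fun y => EReal.le_of_forall_lt_iff_le.1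
    fun b hb => ?_
  have hlim : Tendsto (fun j => b - logMGF μ (Matrix.toEuclideanLin Cᵀ y) +
      logMGF (ν (k j)) (Matrix.toEuclideanLin Cᵀ y) + ε (k j)) atTop (𝓝 b) := by
    have := ((hL k _ _ hk (tendsto_const_nhds (x := Matrix.toEuclideanLin Cᵀ y))).const_add
      (b - logMGF μ (Matrix.toEuclideanLin Cᵀ y))).add (hε.comp hk)
    simpa using this
  refine dualObj_le_of_tendsto hg hα hL hk hz hlim ?_
  filter_upwards [hk.eventually hmin] with j hj
  rw [EReal.coe_add]
  exact le_trans hj (add_le_add_left ((iInf_le _ y).trans (dualObj_le_of_dualObj_le hg hα hb.le _)) _)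

lemma dualObj_convex (hg : Proper g) (hα : 0 < α) {ν : Measure (Vec d)} [IsProbabilityMeasure ν]
    (hK : IsCompact K) (h : ν Kᶜ = 0) {y z : Vec m} {a b t : ℝ} (h0 : 0 ≤ t) (h1 : t ≤ 1)
    (hy : dualObj g C α ν y ≤ a) (hz : dualObj g C α ν z ≤ b) :
    dualObj g C α ν (t • y + (1 - t) • z) ≤ ((t * a + (1 - t) * b : ℝ) : EReal) := by
  rw [dualObj_le_coe_iff hg hα] at hy hz ⊢
  intro x r hx
  have e1 := mul_le_mul_of_nonneg_left (hy x r hx) h0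
  have e2 := mul_le_mul_of_nonneg_left (hz x r hx) (sub_nonneg.2 h1)
  have e3 := logMGF_convex hK h (Matrix.toEuclideanLin Cᵀ y) (Matrix.toEuclideanLin Cᵀ z) h0 h1
  rw [map_add, map_smul, map_smul, inner_add_right, real_inner_smul_right, real_inner_smul_right]
  linarith

/-- If the limiting dual problem has a unique minimizer, approximate minimizers converge to it. -/
lemma tendsto_of_argmin_eq_singleton (hg : Proper g) (hα : 0 < α) (hK : IsCompact K)
    (hν : ∀ᶠ n in atTop, IsProbabilityMeasure (ν n) ∧ ν n Kᶜ = 0)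
    (hL : ∀ (k : ℕ → ℕ) (w : ℕ → Vec d) (w₀ : Vec d), Tendsto k atTop atTop →
      Tendsto w atTop (𝓝 w₀) → Tendsto (fun j => logMGF (ν (k j)) (w j)) atTop (𝓝 (logMGF μ w₀)))
    {ε : ℕ → ℝ} (hε0 : ∀ n, 0 ≤ ε n) (hε : Tendsto ε atTop (𝓝 0)) {z : ℕ → Vec m}
    (hmin : ∀ᶠ n in atTop, IsApproxMin (dualObj g C α (ν n)) (ε n) (z n))
    {zbar : Vec m} (hbar : argmin (dualObj g C α μ) = {zbar})
    (hfin : ∃ (y : Vec m) (b : ℝ), dualObj g C α μ y ≤ b) :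
    Tendsto z atTop (𝓝 zbar) := by
  have hzbar : dualObj g C α μ zbar ≤ ⨅ y, dualObj g C α μ y := by
    have : zbar ∈ argmin (dualObj g C α μ) := hbar ▸ rfl
    exact this
  obtain ⟨a, ha⟩ : ∃ a : ℝ, dualObj g C α μ zbar = a := by
    obtain ⟨y, b, hy⟩ := hfin
    exact ⟨_, (EReal.coe_toReal
      (ne_of_lt (((hzbar.trans (iInf_le _ y)).trans hy).trans_lt (EReal.coe_lt_top b)))
      (bot_lt_dualObj hg hα zbar).ne').symm⟩
  rw [Metric.tendsto_atTop]
  by_contra! hcon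
  obtain ⟨ρ, hρ, hfar⟩ := hcon
  obtain ⟨N, hN⟩ := eventually_atTop.1 (hν.and hmin)
  choose! k hkge hkdist using hfar
  -- The shift by $N$ keeps every index in the range where the eventual hypotheses hold.
  have hkN : ∀ j, N ≤ k (N + j) := fun j => (Nat.le_add_right N j).trans (hkge _)
  have hkt : Tendsto (fun j => k (N + j)) atTop atTop :=
    tendsto_atTop_mono (fun j => (Nat.le_add_left j N).trans (hkge (N + j))) tendsto_id
  set t : ℕ → ℝ := fun j => ρ / dist (z (k (N + j))) zbar with ht
  have hd : ∀ j, ρ ≤ dist (z (k (N + j))) zbar := fun j => hkdist (N + j)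
  have ht0 : ∀ j, 0 ≤ t j := fun j => div_nonneg hρ.le dist_nonneg
  have ht1 : ∀ j, t j ≤ 1 := fun j => div_le_one_of_le₀ (hd j) dist_nonneg
  -- Pull the distant points back along segments to the compact sphere of radius $\rho$. By
  -- convexity they remain nearly optimal, so a limit on the sphere is a second minimizer.
  set w : ℕ → Vec m := fun j => t j • z (k (N + j)) + (1 - t j) • zbar with hw
  have hwdist : ∀ j, w j ∈ Metric.sphere zbar ρ := fun j => by
    have : w j - zbar = t j • (z (k (N + j)) - zbar) := by simp only [hw]; module
    rw [mem_sphere_iff_norm, this, norm_smul, Real.norm_of_nonneg (ht0 j), ← dist_eq_norm, ht,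
      div_mul_cancel₀ _ (hρ.trans_le (hd j)).ne']
  obtain ⟨w₀, hw₀, s, hs, hws⟩ := (isCompact_sphere zbar ρ).tendsto_subseq hwdist
  set L : ℕ → ℝ := fun n => a - logMGF μ (Matrix.toEuclideanLin Cᵀ zbar) +
    logMGF (ν n) (Matrix.toEuclideanLin Cᵀ zbar) with hLdef
  have hks : Tendsto (fun j => k (N + s j)) atTop atTop := hkt.comp hs.tendsto_atTop
  have hlim : Tendsto (fun j => L (k (N + s j)) + ε (k (N + s j))) atTop (𝓝 a) := by
    have := ((hL _ _ _ hks (tendsto_const_nhds (x := Matrix.toEuclideanLin Cᵀ zbar))).const_add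
      (a - logMGF μ (Matrix.toEuclideanLin Cᵀ zbar))).add (hε.comp hks)
    simpa using this
  have hw₀le : dualObj g C α μ w₀ ≤ a := by
    refine dualObj_le_of_tendsto hg hα hL hks hws hlim (Eventually.of_forall fun j => ?_)
    obtain ⟨⟨hprob, hsupp⟩, happ⟩ := hN _ (hkN (s j))
    have e1 : dualObj g C α (ν (k (N + s j))) zbar ≤ (L (k (N + s j)) : EReal) :=
      dualObj_le_of_dualObj_le hg hα ha.le _
    have e2 : dualObj g C α (ν (k (N + s j))) (z (k (N + s j))) ≤
        ((L (k (N + s j)) + ε (k (N + s j)) : ℝ) : EReal) := by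
      rw [EReal.coe_add]
      exact le_trans happ (add_le_add_left ((iInf_le _ zbar).trans e1) _)
    refine (dualObj_convex hg hα hK hsupp (ht0 (s j)) (ht1 (s j)) e2 e1).trans
      (EReal.coe_le_coe_iff.2 ?_)
    have := mul_le_mul_of_nonneg_right (ht1 (s j)) (hε0 (k (N + s j)))
    linarith
  have hmem : w₀ ∈ argmin (dualObj g C α μ) :=
    show dualObj g C α μ w₀ ≤ _ from (hw₀le.trans ha.ge).trans hzbar
  rw [hbar, Set.mem_singleton_iff] at hmem
  rw [mem_sphere_iff_norm, hmem, sub_self, norm_zero] at hw₀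
  exact hρ.ne hw₀

end Stability

end MEM

end

/-! ### Consistency of the empirical MEM solutions. -/

theorem mainTheorem2 {m d : ℕ} {Ω : Type*} [MeasurableSpace Ω]
    (P : Measure Ω) [IsProbabilityMeasure P]
    (K : Set (MEM.Vec d)) (hK : IsCompact K)
    (μ : Measure (MEM.Vec d))
    (X : ℕ → Ω → MEM.Vec d)
    (hX_meas : ∀ i, Measurable (X i))
    (hX_mem : ∀ i ω, X i ω ∈ K)
    (hX_law : ∀ i, P.map (X i) = μ)
    (hX_indep : ProbabilityTheory.iIndepFun X P)
    (C : Matrix (Fin m) (Fin d) ℝ) (α : ℝ) (hα : 0 < α)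
    (g : MEM.Vec m → EReal)
    (hg_proper : MEM.Proper g) (hg_lsc : LowerSemicontinuous g) (hg_convex : MEM.ConvexFun g)
    (hdom : (0 : MEM.Vec m) ∈
      interior (MEM.dom g - Matrix.toEuclideanLin C '' MEM.dom (MEM.memFun K μ))) :
    ∃ xbar : MEM.Vec d, MEM.argmin (MEM.primalObj g C α K μ) = {xbar} ∧
      ∃ Ξ : Set Ω, MeasurableSet Ξ ∧ P Ξ = 1 ∧ ∀ ω ∈ Ξ,
        ∀ (ε : ℕ → ℝ) (z : ℕ → MEM.Vec m) (x : ℕ → MEM.Vec d),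
          Antitone ε → Tendsto ε atTop (𝓝 0) →
          (∀ᶠ n in atTop,
            MEM.IsApproxMin (MEM.dualObj g C α (MEM.empirical X n ω)) (ε n) (z n)) →
          (∀ n, x n =
            gradient (MEM.logMGF (MEM.empirical X n ω)) (Matrix.toEuclideanLin Cᵀ (z n))) →
          (∀ (k : ℕ → ℕ) (zlim : MEM.Vec m), StrictMono k →
            Tendsto (fun j => z (k j)) atTop (𝓝 zlim) →
            Tendsto (fun j => x (k j)) atTop (𝓝 xbar)) ∧
          ((∃ zbar : MEM.Vec m, MEM.argmin (MEM.dualObj g C α μ) = {zbar}) →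
            Tendsto x atTop (𝓝 xbar)) := by
  have hμ : IsProbabilityMeasure μ :=
    hX_law 0 ▸ Measure.isProbabilityMeasure_map (hX_meas 0).aemeasurable
  have hμK : μ Kᶜ = 0 := by
    rw [← hX_law 0, Measure.map_apply (hX_meas 0) hK.measurableSet.compl]
    convert! measure_empty (μ := P)
    ext ω
    simp [hX_mem]
  obtain ⟨z₀, hz₀⟩ := MEM.exists_mem_argmin_dualObj hg_proper hg_lsc hg_convex hα hK hμK hdom
  have hprimal := MEM.argmin_primalObj_eq hg_proper hg_lsc hg_convex hα hK hμK hz₀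
  refine ⟨_, hprimal, ?_⟩
  have hxbar : ∀ z ∈ MEM.argmin (MEM.dualObj g C α μ),
      MEM.tiltedMean μ (Matrix.toEuclideanLin Cᵀ z) =
        MEM.tiltedMean μ (Matrix.toEuclideanLin Cᵀ z₀) := fun z hz =>
    Set.singleton_injective ((MEM.argmin_primalObj_eq hg_proper hg_lsc hg_convex hα hK hμK
      hz).symm.trans hprimal)
  obtain ⟨Ξ, hΞ, hΞm, hΞP⟩ := (MEM.ae_tendsto_logMGF_tiltedMean hK hX_meas hX_mem hX_law
    hX_indep).exists_measurable_mem
  refine ⟨Ξ, hΞm, (prob_compl_eq_zero_iff hΞm).1 hΞ, fun ω hω ε z x hanti hε hmin hx => ?_⟩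
  have hlim := hΞP ω hω
  have hprob : ∀ᶠ n in atTop, IsProbabilityMeasure (MEM.empirical X n ω) ∧
      MEM.empirical X n ω Kᶜ = 0 := by
    -- For $n=0$ the empirical measure is zero, hence not a probability measure.
    filter_upwards [eventually_ne_atTop 0] with n hn
    exact ⟨MEM.isProbabilityMeasure_empirical hn ω,
      MEM.empirical_compl_eq_zero hK.measurableSet hX_mem n ω⟩
  have hxt : ∀ᶠ n in atTop,
      MEM.tiltedMean (MEM.empirical X n ω) (Matrix.toEuclideanLin Cᵀ (z n)) = x n := by
    filter_upwards [hprob] with n ⟨hn, hnK⟩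
    rw [hx, (MEM.hasGradientAt_logMGF hK hnK _).gradient]
  have hC : Continuous (Matrix.toEuclideanLin Cᵀ) := LinearMap.continuous_of_finiteDimensional _
  have hsub : ∀ (k : ℕ → ℕ) (zlim : MEM.Vec m), StrictMono k →
      Tendsto (fun j => z (k j)) atTop (𝓝 zlim) →
      Tendsto (fun j => x (k j)) atTop (𝓝 (MEM.tiltedMean μ (Matrix.toEuclideanLin Cᵀ z₀))) := by
    intro k zlim hk hz
    rw [← hxbar zlim (MEM.mem_argmin_of_tendsto hg_proper hα
      (fun k w w₀ hk hw => (hlim k w w₀ hk hw).1) hε hmin hk.tendsto_atTop hz)]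
    refine Tendsto.congr' (hk.tendsto_atTop.eventually hxt)
      (hlim k _ _ hk.tendsto_atTop ((hC.tendsto zlim).comp hz)).2
  refine ⟨hsub, fun ⟨zbar, hbar⟩ => hsub id zbar strictMono_id ?_⟩
  exact MEM.tendsto_of_argmin_eq_singleton hg_proper hα hK hprob
    -- Nonnegativity of $\varepsilon_n$ follows from its decrease to $0$.
    (fun k w w₀ hk hw => (hlim k w w₀ hk hw).1) (fun n => hanti.le_of_tendsto hε n) hε hmin hbar
    (MEM.exists_dualObj_le_coe hg_proper hg_lsc hg_convex hα)
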